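/- Let $\mathbb C$ be a finitely cocomplete homological category, i.e. a pointed, regular, (Bourn-)protomodular category with finite colimits. For objects $X,Y$ let $\iota\colon (X|Y)\to X+Y$ be the kernel of the canonical map $X+Y\to X\times Y$, and for $f\colon X\to X'$, $g\colon Y\to Y'$ let $(f|g)\colon (X|Y)\to (X'|Y')$ be the restriction of $f+g$. Let $c_2^A\colon (A|A)\to A$ (the conjugation action of $A$ on itself) be the composite of $\iota\colon (A|A)\to A+A$ with the codiagonal $A+A\to A$. A subobject $x\colon X\rightarrowtail A$ is called *proper* if it is the kernel of some morphism with domain $A$; it is called *stable under the conjugation action of $A$* if $c_2^A\circ(x|1_A)\colon (X|A)\to A$ factors through $x$. For subobjects $x\colon X\rightarrowtail A$ and $y\colon Y\rightarrowtail A$, their commutator $[X,Y]$ is the image of $c_2^A\circ(x|y)\colon (X|Y)\to A$, a subobject of $A$. Then the following conditions are equivalent: 1. $\mathbb C$ is semi-abelian, i.e. pointed, Barr exact and protomodular with binary sums; 2. $\mathbb C$ is Barr exact, i.e. regular and such that every internal equivalence relation is the kernel pair of some morphism; 3. property (P): for every object $A$ of $\mathbb C$, a subobject $X$ of $A$ is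 proper if and only if it is stable under the conjugation action of $A$; 4. property (P) in terms of commutators: for every object $A$ of $\mathbb C$, a subobject $X$ of $A$ is proper if and only if $[X,A]\subset X$. -/

import Mathlib

open CategoryTheory CategoryTheory.Limits

universe v u

namespace HomologicalCat

section Classes

variable (C : Type u) [Category.{v} C]

/-- Bourn-protomodular category (with pullbacks): every change-of-base functor
`v^* : Pt_B(C) ⥤ Pt_{B'}(C)` between categories of points reflects isomorphisms.
A point over `B` is a morphism `p : E ⟶ B` with a chosen section `s`; a morphism of points over `B`
is a morphism `f` of `C` compatible with the projections and the sections (it is an isomorphism of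
points iff it is one in `C`). Here `P₁`, `P₂` are the pullbacks of the two points along `v`, and
`f' = v^* f` is the morphism that `f` induces between them. -/
class Protomodular [HasPullbacks C] : Prop where
  isIso_of_isIso_baseChange : ∀ {B B' E₁ E₂ P₁ P₂ : C} (v : B' ⟶ B)
    (p₁ : E₁ ⟶ B) (s₁ : B ⟶ E₁) (p₂ : E₂ ⟶ B) (s₂ : B ⟶ E₂) (f : E₁ ⟶ E₂)
    (t₁ : P₁ ⟶ E₁) (q₁ : P₁ ⟶ B') (t₂ : P₂ ⟶ E₂) (q₂ : P₂ ⟶ B') (f' : P₁ ⟶ P₂),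
    s₁ ≫ p₁ = 𝟙 B → s₂ ≫ p₂ = 𝟙 B → f ≫ p₂ = p₁ → s₁ ≫ f = s₂ →
    IsPullback t₁ q₁ p₁ v → IsPullback t₂ q₂ p₂ v →
    f' ≫ t₂ = t₁ ≫ f → f' ≫ q₂ = q₁ →
    IsIso f' → IsIso f

/-- Barr exact category: a regular category in which every internal equivalence relation is
effective, i.e. is the kernel pair of some morphism. -/
class BarrExact : Prop extends Regular C where
  isKernelPair_of_isEquivalenceRelation : ∀ {R X : C} (p₁ p₂ : R ⟶ X),
    IsEquivalenceRelation p₁ p₂ → ∃ (Q : C) (q : X ⟶ Q), IsKernelPair q p₁ p₂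

/-- Homological category: pointed, regular and protomodular. -/
class Homological : Prop extends Regular C, HasZeroObject C, Protomodular C

/-- Semi-abelian category: pointed, Barr exact and protomodular, with binary sums. -/
class SemiAbelian : Prop extends BarrExact C, HasZeroObject C, Protomodular C,
  HasBinaryCoproducts C

end Classes

noncomputable section CrossEffect

variable {C : Type u} [Category.{v} C] [HasZeroMorphisms C] [HasFiniteLimits C]
  [HasBinaryCoproducts C]

/-- The canonical map `X + Y ⟶ X × Y`, with components the retractions `r_X = ⟨1, 0⟩` and
`r_Y = ⟨0, 1⟩`. -/
def sumToProd (X Y : C) : X ⨿ Y ⟶ X ⨯ Y :=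
  prod.lift (coprod.desc (𝟙 X) 0) (coprod.desc 0 (𝟙 Y))

theorem sumToProd_naturality {X Y X' Y' : C} (f : X ⟶ X') (g : Y ⟶ Y') :
    sumToProd X Y ≫ prod.map f g = coprod.map f g ≫ sumToProd X' Y' := by
  ext <;> simp [sumToProd]

/-- `(X|Y)`, the second cross effect of the identity functor: the kernel of `X + Y ⟶ X × Y`. -/
abbrev crossEffect (X Y : C) : C := kernel (sumToProd X Y)

/-- The inclusion `ι : (X|Y) ⟶ X + Y`. -/
def crossEffectι (X Y : C) : crossEffect X Y ⟶ X ⨿ Y := kernel.ι (sumToProd X Y)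

/-- The map `(f|g) : (X|Y) ⟶ (X'|Y')` induced by `f + g` on the kernels. -/
def crossEffectMap {X Y X' Y' : C} (f : X ⟶ X') (g : Y ⟶ Y') :
    crossEffect X Y ⟶ crossEffect X' Y' :=
  kernel.map (sumToProd X Y) (sumToProd X' Y') (coprod.map f g) (prod.map f g)
    (sumToProd_naturality f g)

/-- The conjugation action `c₂ : (A|A) ⟶ A` of `A` on itself: the inclusion `ι` followed by the
codiagonal. -/
def conj (A : C) : crossEffect A A ⟶ A :=
  crossEffectι A A ≫ coprod.desc (𝟙 A) (𝟙 A)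

/-- A subobject `x : X ⟶ A` is stable under the conjugation action of `A` if `c₂ ∘ (x|1)` factors
through `x`. -/
def IsConjStable {A : C} (X : Subobject A) : Prop :=
  ∃ c : crossEffect (X : C) A ⟶ (X : C),
    c ≫ X.arrow = crossEffectMap X.arrow (𝟙 A) ≫ conj A

/-- The commutator `[X, Y]` of two subobjects of `A`: the image of
`c₂ ∘ (x|y) : (X|Y) ⟶ A`. -/
def commutator [HasImages C] {A : C} (X Y : Subobject A) : Subobject A :=
  imageSubobject (crossEffectMap X.arrow Y.arrow ≫ conj A)

/-- A subobject is proper if it is the kernel of some morphism. -/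
def IsProper {A : C} (X : Subobject A) : Prop :=
  ∃ (B : C) (f : A ⟶ B), X = kernelSubobject f

end CrossEffect

end HomologicalCat

/-!
Stability under conjugation is a statement about the morphism `(X|A) ⟶ X + A ⟶ A` with second
component `[x, 1]`. Kernels are always stable, because `[x, 1] ≫ f = [0, f]` factors through
`X × A` when `x` is a kernel of `f`.

All uses of protomodularity go through one lemma, `isIso_of_mono_of_factors`: if `p : E ⟶ B` has a
section `s` and `P` is the pullback of `E` along some `v : B' ⟶ B`, then a subobject of `E` through
which both `s` and `P ⟶ E` factor is the whole of `E`. With `B' = 0` it says that the section and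
the kernel of a split epimorphism are jointly extremal epic (`exists_lift_of_kernel`); with `v`
a split monomorphism it gives `difunctional`: every relation is difunctional, hence every reflexive
relation is an equivalence relation (the Mal'tsev property).

*Exactness implies property (P).* Let `x : X ⟶ A` be stable. The kernel of `[0, 1] : X + A ⟶ A` is a
split extension of `X` by `(X|A)`, so stability forces `[x, 1]` to map this kernel into `X`
(`factors_of_comp_desc_eq_zero`). The image `R` of `([0, 1], [x, 1]) : X + A ⟶ A × A` is a reflexive
relation, so by exactness it is the kernel pair of some `q`. As regular epimorphisms are stable under
pullback, the zero class of `R`, i.e. the kernel of `q`, is the image of the kernel of `[0, 1]`,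
which is `X`.

*Property (P) implies exactness.* For an equivalence relation `(r₁, r₂)` on `A`, the zero class
`ker r₁ ⟶ R ⟶ A` is stable, because `ker r₁` is stable in `R` and the diagonal `A ⟶ R` transports
the action (`exists_conj_factor_of_reflexive`). So it is the kernel of some `f`, and the relation is
the kernel pair of `f`, because by `exists_lift_of_kernel` a reflexive relation on `A` is
contained in another one as soon as its zero class is (`isKernelPair_of_zeroClass`).
-/

namespace HomologicalCat

attribute [local simp] prod.lift_fst prod.lift_fst_assoc prod.lift_snd prod.lift_snd_assoc
  coprod.inl_desc coprod.inl_desc_assoc coprod.inr_desc coprod.inr_desc_assoc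
  pullback.lift_fst pullback.lift_fst_assoc pullback.lift_snd pullback.lift_snd_assoc
  kernel.lift_ι kernel.lift_ι_assoc equalizer.lift_ι equalizer.lift_ι_assoc

/-! ### Jointly extremal epic pairs in protomodular categories -/

section Protomodular

variable {C : Type u} [Category.{v} C]

/-- A split epimorphism `p` with section `s` is covered by `s` together with any of its base
changes `t : P ⟶ E`: a subobject containing both is everything. -/
theorem isIso_of_mono_of_factors [HasPullbacks C] [Protomodular C] {B B' E P M : C} {v : B' ⟶ B}
    {p : E ⟶ B} {s : B ⟶ E} (hs : s ≫ p = 𝟙 B) {t : P ⟶ E} {q : P ⟶ B'} (h : IsPullback t q p v)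
    (m : M ⟶ E) [Mono m] (s' : B ⟶ M) (hs' : s' ≫ m = s) (t' : P ⟶ M) (ht' : t' ≫ m = t) :
    IsIso m := by
  -- `P` is also the base change of the point `m ≫ p`, and `m` induces the identity of `P`.
  have h' : IsPullback t' q (m ≫ p) v := by
    refine ⟨⟨by rw [← Category.assoc, ht', h.w]⟩,
      ⟨PullbackCone.IsLimit.mk _ (fun c => h.lift (c.fst ≫ m) c.snd (by simpa using c.condition))
        (fun c => ?_) (fun c => ?_) (fun c l h₁ h₂ => ?_)⟩⟩
    · simp [← cancel_mono m, ht']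
    · simp
    · apply h.hom_ext <;> simp [← h₁, ← h₂, ht']
  exact Protomodular.isIso_of_isIso_baseChange v (m ≫ p) s' p s m t' q t q (𝟙 P)
    (by rw [← Category.assoc, hs', hs]) hs rfl hs' h' h (by simp [ht']) (by simp) inferInstance

/-- If a morphism `g` on a split epimorphism `p` with section `s` factors through a monomorphism `r`
after restriction to `s` and to a base change of `p`, then it factors through `r`. -/
theorem exists_lift_of_baseChange [HasPullbacks C] [Protomodular C] {B B' E P R Z : C} {v : B' ⟶ B}
    {p : E ⟶ B} {s : B ⟶ E} (hs : s ≫ p = 𝟙 B) {t : P ⟶ E} {q : P ⟶ B'} (h : IsPullback t q p v)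
    (r : R ⟶ Z) [Mono r] (g : E ⟶ Z) (a : B ⟶ R) (ha : a ≫ r = s ≫ g) (b : P ⟶ R)
    (hb : b ≫ r = t ≫ g) : ∃ l : E ⟶ R, l ≫ r = g := by
  have := isIso_of_mono_of_factors hs h (pullback.fst g r) (pullback.lift s a ha.symm)
    (pullback.lift_fst _ _ _) (pullback.lift t b hb.symm) (pullback.lift_fst _ _ _)
  exact ⟨inv (pullback.fst g r) ≫ pullback.snd g r, by simp [← pullback.condition]⟩

/-- The section and the kernel of a split epimorphism are jointly extremal epic. -/
theorem exists_lift_of_kernel [HasZeroMorphisms C] [HasZeroObject C] [HasPullbacks C]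
    [HasKernels C] [Protomodular C] {B E R Z : C} {p : E ⟶ B} {s : B ⟶ E} (hs : s ≫ p = 𝟙 B)
    (r : R ⟶ Z) [Mono r] (g : E ⟶ Z) (a : B ⟶ R) (ha : a ≫ r = s ≫ g) (b : kernel p ⟶ R)
    (hb : b ≫ r = kernel.ι p ≫ g) : ∃ l : E ⟶ R, l ≫ r = g := by
  open ZeroObject in
  have h : IsPullback (kernel.ι p) (0 : kernel p ⟶ (0 : C)) p (0 : (0 : C) ⟶ B) := by
    refine ⟨⟨by simp⟩, ⟨PullbackCone.IsLimit.mk _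
      (fun c => kernel.lift p c.fst (by simpa using c.condition))
        (fun c => by simp) (fun c => ?_) (fun c l h₁ _ => ?_)⟩⟩
    · exact (isZero_zero C).eq_of_tgt _ _
    · simp [← cancel_mono (kernel.ι p), h₁]
  exact exists_lift_of_baseChange hs h r g a ha b hb

/-- Let `P` be the pullback of `p` and `q`, and `t` a section of `q`. The inclusion `i = (1, t ∘ p)`
into `P` is jointly extremal epic with any section `j` of the second projection, for instance with
`j = (s ∘ q, 1)` when `s` is a section of `p`. -/
theorem exists_lift_of_pullback [HasPullbacks C] [Protomodular C] {B E D P R Z : C}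
    {p : E ⟶ B} {q : D ⟶ B} {t : B ⟶ D} (ht : t ≫ q = 𝟙 B)
    {fst : P ⟶ E} {snd : P ⟶ D} (h : IsPullback fst snd p q)
    {i : E ⟶ P} (hi₁ : i ≫ fst = 𝟙 E) (hi₂ : i ≫ snd = p ≫ t)
    {j : D ⟶ P} (hj₂ : j ≫ snd = 𝟙 D)
    (r : R ⟶ Z) [Mono r] (g : P ⟶ Z) (a : E ⟶ R) (ha : a ≫ r = i ≫ g)
    (b : D ⟶ R) (hb : b ≫ r = j ≫ g) : ∃ l : P ⟶ R, l ≫ r = g := by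
  -- `E` is the base change of `snd : P ⟶ D` along `t`.
  have h' : IsPullback i p snd t := by
    refine IsPullback.of_right (t := h) ?_ hi₂
    simpa [hi₁, ht] using (IsPullback.of_horiz_isIso (⟨by simp⟩ : CommSq (𝟙 E) p p (𝟙 B)))
  exact exists_lift_of_baseChange hj₂ h' r g b hb a ha

end Protomodular

/-! ### The Mal'tsev property -/

theorem mono_prod_lift {C : Type u} [Category.{v} C] [HasBinaryProducts C] {R X Y : C}
    (r₁ : R ⟶ X) (r₂ : R ⟶ Y) [JointlyMono₂ r₁ r₂] : Mono (prod.lift r₁ r₂) :=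
  ⟨fun f g hfg => JointlyMono₂.right_cancellation (p₁ := r₁) (p₂ := r₂) f g
    (by simpa using hfg =≫ prod.fst) (by simpa using hfg =≫ prod.snd)⟩

section Malcev

variable {C : Type u} [Category.{v} C] [HasFiniteLimits C] [Protomodular C]

/-- Relations in a protomodular category are difunctional: in terms of generalized elements, if
`a R c`, `b R c` and `b R d`, then `a R d`. -/
theorem difunctional {R X Y : C} {r₁ : R ⟶ X} {r₂ : R ⟶ Y} [JointlyMono₂ r₁ r₂] {T : C}
    (u v w : T ⟶ R) (h₂ : u ≫ r₂ = v ≫ r₂) (h₁ : v ≫ r₁ = w ≫ r₁) :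
    ∃ z : T ⟶ R, z ≫ r₁ = u ≫ r₁ ∧ z ≫ r₂ = w ≫ r₂ := by
  have := mono_prod_lift r₁ r₂
  -- `pullback r₂ r₂` consists of the pairs `a R c`, `b R c`, and `pullback r₁ r₁` of the pairs
  -- `b R c`, `b R d`. Over the object `R` of pairs `b R c`, they are split by `a = b` and by
  -- `d = c` respectively; in both cases `a R d` is clear.
  let p : pullback r₂ r₂ ⟶ R := pullback.snd r₂ r₂
  let q : pullback r₁ r₁ ⟶ R := pullback.fst r₁ r₁
  let s : R ⟶ pullback r₂ r₂ := pullback.lift (𝟙 R) (𝟙 R) rfl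
  let t : R ⟶ pullback r₁ r₁ := pullback.lift (𝟙 R) (𝟙 R) rfl
  have hs : s ≫ p = 𝟙 R := pullback.lift_snd _ _ _
  have ht : t ≫ q = 𝟙 R := pullback.lift_fst _ _ _
  have hs' : s ≫ pullback.fst r₂ r₂ = 𝟙 R := pullback.lift_fst _ _ _
  have ht' : t ≫ pullback.snd r₁ r₁ = 𝟙 R := pullback.lift_snd _ _ _
  obtain ⟨l, hl⟩ := exists_lift_of_pullback ht (IsPullback.of_hasPullback p q)
    (i := pullback.lift (𝟙 _) (p ≫ t) (by simp [ht]))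
    (pullback.lift_fst _ _ _) (pullback.lift_snd _ _ _)
    (j := pullback.lift (q ≫ s) (𝟙 _) (by simp [hs])) (pullback.lift_snd _ _ _)
    (prod.lift r₁ r₂)
    (prod.lift (pullback.fst p q ≫ pullback.fst r₂ r₂ ≫ r₁)
      (pullback.snd p q ≫ pullback.snd r₁ r₁ ≫ r₂))
    (pullback.fst r₂ r₂) (by ext <;> simp [reassoc_of% ht', p, pullback.condition])
    (pullback.snd r₁ r₁) (by ext <;> simp [reassoc_of% hs', q, pullback.condition])
  let e : T ⟶ pullback p q :=
    pullback.lift (pullback.lift u v h₂) (pullback.lift v w h₁) (by simp [p, q])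
  refine ⟨e ≫ l, ?_, ?_⟩
  · simpa [e] using e ≫= hl =≫ prod.fst
  · simpa [e] using e ≫= hl =≫ prod.snd

/-- A reflexive relation in a protomodular category is an equivalence relation. -/
theorem isEquivalenceRelation_of_reflexive {R X : C} {r₁ r₂ : R ⟶ X} [JointlyMono₂ r₁ r₂]
    (s : X ⟶ R) (h₁ : s ≫ r₁ = 𝟙 X) (h₂ : s ≫ r₂ = 𝟙 X) : IsEquivalenceRelation r₁ r₂ := by
  -- Symmetry: from `b R b`, `a R b`, `a R a` follows `b R a`.
  obtain ⟨σ, hσ₁, hσ₂⟩ := difunctional (r₁ := r₁) (r₂ := r₂) (r₂ ≫ s) (𝟙 R) (r₁ ≫ s)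
    (by simp [h₂]) (by simp [h₁])
  -- Transitivity: from `a R b`, `b R b`, `b R c` follows `a R c`.
  obtain ⟨τ, hτ₁, hτ₂⟩ := difunctional (r₁ := r₁) (r₂ := r₂) (pullback.fst r₂ r₁)
    (pullback.fst r₂ r₁ ≫ r₂ ≫ s) (pullback.snd r₂ r₁) (by simp [h₂])
    (by simp [h₁, pullback.condition])
  exact ⟨⟨{
    right_cancellation := JointlyMono₂.right_cancellation
    r := s
    reflexivity₁ := h₁
    reflexivity₂ := h₂
    s := σ
    symmetry₁ := by simpa [h₁] using hσ₁
    symmetry₂ := by simpa [h₂] using hσ₂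
    c := _
    isLimit := pullbackIsPullback r₂ r₁
    t := τ
    transitivity₁ := hτ₁
    transitivity₂ := hτ₂ }⟩⟩

end Malcev

/-! ### Stability under conjugation -/

section Conjugation

variable {C : Type u} [Category.{v} C] [HasZeroMorphisms C] [HasFiniteLimits C]
  [HasBinaryCoproducts C]

theorem crossEffectMap_comp_ι {X Y X' Y' : C} (f : X ⟶ X') (g : Y ⟶ Y') :
    crossEffectMap f g ≫ crossEffectι X' Y' = crossEffectι X Y ≫ coprod.map f g := by
  simp [crossEffectMap, crossEffectι]

theorem crossEffectMap_comp_conj {X Y A : C} (f : X ⟶ A) (g : Y ⟶ A) :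
    crossEffectMap f g ≫ conj A = crossEffectι X Y ≫ coprod.desc f g := by
  simp [conj, reassoc_of% (@crossEffectMap_comp_ι C)]

theorem crossEffectι_comp_desc_zero_left {X Y Z : C} (g : Y ⟶ Z) :
    crossEffectι X Y ≫ coprod.desc 0 g = 0 := by
  have h : coprod.desc (0 : X ⟶ Z) g = sumToProd X Y ≫ prod.snd ≫ g := by ext <;> simp [sumToProd]
  rw [h, crossEffectι, kernel.condition_assoc, zero_comp]

theorem isConjStable_iff {A : C} (X : Subobject A) :
    IsConjStable X ↔
      X.Factors (crossEffectι (X : C) A ≫ coprod.desc X.arrow (𝟙 A)) := by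
  rw [IsConjStable, crossEffectMap_comp_conj]
  exact ⟨fun ⟨c, hc⟩ => hc ▸ Subobject.factors_comp_arrow c,
    fun h => ⟨X.factorThru _ h, by simp⟩⟩

theorem isConjStable_mk {X A : C} (x : X ⟶ A) [Mono x] (c : crossEffect X A ⟶ X)
    (hc : c ≫ x = crossEffectι X A ≫ coprod.desc x (𝟙 A)) : IsConjStable (Subobject.mk x) := by
  let i := Subobject.underlyingIso x
  have hi : i.hom ≫ x = (Subobject.mk x).arrow := Subobject.underlyingIso_hom_comp_eq_mk x
  refine ⟨crossEffectMap i.hom (𝟙 A) ≫ c ≫ i.inv, ?_⟩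
  rw [crossEffectMap_comp_conj, Category.assoc, Category.assoc,
    Subobject.underlyingIso_arrow, hc, reassoc_of% (@crossEffectMap_comp_ι C)]
  simp [hi]

/-- Kernels are stable under conjugation, without any exactness assumption. -/
theorem IsProper.isConjStable {A : C} {X : Subobject A} (hX : IsProper X) : IsConjStable X := by
  obtain ⟨B, f, rfl⟩ := hX
  rw [isConjStable_iff, kernelSubobject_factors_iff]
  have h : coprod.desc (kernelSubobject f).arrow (𝟙 A) ≫ f = coprod.desc 0 f := by ext <;> simp
  rw [Category.assoc, h, crossEffectι_comp_desc_zero_left]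

/-- The zero class of a reflexive relation is stable under conjugation: `ker r₁` is stable under
conjugation in `R`, and the diagonal `s` turns conjugation by `A` into conjugation by `R`. -/
theorem exists_conj_factor_of_reflexive {R A : C} {r₁ r₂ : R ⟶ A} (s : A ⟶ R)
    (h₂ : s ≫ r₂ = 𝟙 A) :
    ∃ c : crossEffect (kernel r₁) A ⟶ kernel r₁, c ≫ kernel.ι r₁ ≫ r₂ =
      crossEffectι (kernel r₁) A ≫ coprod.desc (kernel.ι r₁ ≫ r₂) (𝟙 A) := by
  refine ⟨kernel.lift r₁ (crossEffectι (kernel r₁) A ≫ coprod.desc (kernel.ι r₁) s) ?_, ?_⟩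
  · simp [crossEffectι_comp_desc_zero_left]
  · simp [h₂]

theorem commutator_top_le_iff [HasImages C] {A : C} (X : Subobject A) :
    commutator X ⊤ ≤ X ↔ IsConjStable X := by
  have hι : crossEffectι (X : C) ((⊤ : Subobject A) : C) ≫
      coprod.desc X.arrow (⊤ : Subobject A).arrow =
      crossEffectMap (𝟙 _) (⊤ : Subobject A).arrow ≫
        crossEffectι (X : C) A ≫ coprod.desc X.arrow (𝟙 A) := by
    simp [reassoc_of% (@crossEffectMap_comp_ι C)]
  have hι' : crossEffectι (X : C) A ≫ coprod.desc X.arrow (𝟙 A) =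
      crossEffectMap (𝟙 _) (inv (⊤ : Subobject A).arrow) ≫
        crossEffectι (X : C) _ ≫ coprod.desc X.arrow (⊤ : Subobject A).arrow := by
    simp [reassoc_of% (@crossEffectMap_comp_ι C)]
  simp only [isConjStable_iff, commutator, crossEffectMap_comp_conj]
  constructor
  · intro h
    rw [hι']
    refine Subobject.factors_of_factors_right _ (Subobject.factors_of_le _ h ?_)
    have h' := Subobject.factors_comp_arrow (factorThruImageSubobject
      (crossEffectι (X : C) ((⊤ : Subobject A) : C) ≫
        coprod.desc X.arrow (⊤ : Subobject A).arrow))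
    rwa [imageSubobject_arrow_comp] at h'
  · intro h
    have h' := Subobject.factors_of_factors_right
      (crossEffectMap (𝟙 (X : C)) (⊤ : Subobject A).arrow) h
    rw [← hι] at h'
    exact imageSubobject_le _ (X.factorThru _ h') (by simp)

end Conjugation

/-! ### Zero classes of equivalence relations -/

/-- The zero class of a relation is a subobject. -/
theorem mono_zeroClass {C : Type u} [Category.{v} C] [HasZeroMorphisms C] [HasKernels C] {R A : C}
    (r₁ r₂ : R ⟶ A) [JointlyMono₂ r₁ r₂] : Mono (kernel.ι r₁ ≫ r₂) :=
  ⟨fun f g h => (cancel_mono (kernel.ι r₁)).1 <|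
    JointlyMono₂.right_cancellation (p₁ := r₁) (p₂ := r₂) _ _ (by simp) (by simpa using h)⟩

section ZeroClass

variable {C : Type u} [Category.{v} C] [HasZeroMorphisms C] [HasZeroObject C] [HasFiniteLimits C]
  [Protomodular C]

/-- A reflexive relation is determined by its zero class: if the latter is a kernel of `f`, the
relation is the kernel pair of `f`. -/
theorem isKernelPair_of_zeroClass {R A B : C} {r₁ r₂ : R ⟶ A} [JointlyMono₂ r₁ r₂]
    (s : A ⟶ R) (h₁ : s ≫ r₁ = 𝟙 A) (h₂ : s ≫ r₂ = 𝟙 A) (f : A ⟶ B)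
    (hf : (kernel.ι r₁ ≫ r₂) ≫ f = 0)
    (hl : ∀ {T : C} (t : T ⟶ A), t ≫ f = 0 → ∃ l : T ⟶ kernel r₁, l ≫ kernel.ι r₁ ≫ r₂ = t) :
    IsKernelPair f r₁ r₂ := by
  have := mono_prod_lift r₁ r₂
  have w : r₁ ≫ f = r₂ ≫ f := by
    obtain ⟨l, hl⟩ := exists_lift_of_kernel h₁ (equalizer.ι (r₁ ≫ f) (r₂ ≫ f)) (𝟙 R)
      (equalizer.lift s (by simp [reassoc_of% h₁, reassoc_of% h₂])) (by simp)
      (equalizer.lift (kernel.ι r₁) (by simpa using hf.symm)) (by simp)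
    rw [← Category.id_comp (r₁ ≫ f), ← hl, Category.assoc, equalizer.condition,
      reassoc_of% hl]
  -- The kernel pair of `f` is contained in `R`, since `R` contains the diagonal and the zero class
  -- of this kernel pair.
  let p : pullback f f ⟶ A := pullback.fst f f
  let d : A ⟶ pullback f f := pullback.lift (𝟙 A) (𝟙 A) rfl
  have hd : d ≫ p = 𝟙 A := pullback.lift_fst _ _ _
  have hd' : d ≫ pullback.snd f f = 𝟙 A := pullback.lift_snd _ _ _
  obtain ⟨z, hz⟩ := hl (kernel.ι p ≫ pullback.snd f f) (by
    rw [Category.assoc, ← pullback.condition]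
    exact (kernel.condition_assoc p f).trans zero_comp)
  obtain ⟨l, hl⟩ := exists_lift_of_kernel hd (prod.lift r₁ r₂) (prod.lift p (pullback.snd f f))
    s (by ext <;> simp [hd, hd', h₁, h₂]) (z ≫ kernel.ι r₁) (by ext <;> simp [hz])
  have hl₁ : l ≫ r₁ = pullback.fst f f := by simpa using hl =≫ prod.fst
  have hl₂ : l ≫ r₂ = pullback.snd f f := by simpa using hl =≫ prod.snd
  exact ⟨⟨w⟩, ⟨PullbackCone.IsLimit.mk _
    (fun c => pullback.lift c.fst c.snd c.condition ≫ l)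
    (fun c => by simp [hl₁]) (fun c => by simp [hl₂]) (fun c n hn₁ hn₂ =>
      JointlyMono₂.right_cancellation (p₁ := r₁) (p₂ := r₂) _ _
        (by simp [hl₁, hn₁]) (by simp [hl₂, hn₂]))⟩⟩

end ZeroClass

/-! ### Property (P) and exactness -/

section Exactness

variable {C : Type u} [Category.{v} C] [HasZeroMorphisms C]

/-- If `x` is stable under conjugation, then `[x, 1]` maps the kernel of `[0, 1] : X + A ⟶ A` into
`X`: this kernel is covered by `X` and `(X|A)`. -/
theorem factors_of_comp_desc_eq_zero [HasZeroObject C] [HasFiniteLimits C]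
    [HasBinaryCoproducts C] [Protomodular C] {A : C} {X : Subobject A} (hX : IsConjStable X)
    {T : C} (t : T ⟶ (X : C) ⨿ A) (ht : t ≫ coprod.desc 0 (𝟙 A) = 0) :
    X.Factors (t ≫ coprod.desc X.arrow (𝟙 A)) := by
  obtain ⟨c, hc⟩ := hX
  rw [crossEffectMap_comp_conj] at hc
  let π : (X : C) ⨿ A ⟶ A := coprod.desc 0 (𝟙 A)
  -- The kernel of `π` is a split extension of `X` by `(X|A)`.
  let p : kernel π ⟶ (X : C) := kernel.ι π ≫ coprod.desc (𝟙 _) 0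
  let s : (X : C) ⟶ kernel π := kernel.lift π coprod.inl (by simp [π])
  have hs : s ≫ p = 𝟙 _ := by simp [s, p]
  have hp : kernel.ι p ≫ kernel.ι π ≫ coprod.desc (𝟙 (X : C)) (0 : A ⟶ X) = 0 :=
    kernel.condition p
  have hπ : kernel.ι π ≫ coprod.desc (0 : (X : C) ⟶ A) (𝟙 A) = 0 := kernel.condition π
  let j : kernel p ⟶ crossEffect (X : C) A :=
    kernel.lift _ (kernel.ι p ≫ kernel.ι π) (by ext <;> simp [sumToProd, hp, hπ])
  have hj : j ≫ crossEffectι (X : C) A = kernel.ι p ≫ kernel.ι π := kernel.lift_ι _ _ _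
  obtain ⟨l, hl⟩ := exists_lift_of_kernel hs X.arrow (kernel.ι π ≫ coprod.desc X.arrow (𝟙 A))
    (𝟙 _) (by simp [s]) (j ≫ c) (by rw [Category.assoc, hc, reassoc_of% hj])
  rw [← kernel.lift_ι π t ht, Category.assoc, ← hl]
  exact Subobject.factors_of_factors_right _ (Subobject.factors_comp_arrow l)

/-- In the Barr exact case, a stable subobject `X` of `A` is a kernel: it is the zero class of the
reflexive relation on `A` generated by `(0, x)`, that is, of the image of `([0, 1], [x, 1])`. -/
theorem IsConjStable.isProper [BarrExact C] [HasZeroObject C] [HasBinaryCoproducts C]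
    [Protomodular C] {A : C} {X : Subobject A} (hX : IsConjStable X) : IsProper X := by
  let φ : (X : C) ⨿ A ⟶ A ⨯ A :=
    prod.lift (coprod.desc 0 (𝟙 A)) (coprod.desc X.arrow (𝟙 A))
  let F := Regular.strongEpiMonoFactorisation φ
  let r₁ : F.I ⟶ A := F.m ≫ prod.fst
  let r₂ : F.I ⟶ A := F.m ≫ prod.snd
  have hr₁ : F.e ≫ r₁ = coprod.desc 0 (𝟙 A) := by
    rw [← Category.assoc, F.fac, prod.lift_fst]
  have hr₂ : F.e ≫ r₂ = coprod.desc X.arrow (𝟙 A) := by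
    rw [← Category.assoc, F.fac, prod.lift_snd]
  have : JointlyMono₂ r₁ r₂ := ⟨fun _ f g hfg₁ hfg₂ => by
    rw [← cancel_mono F.m]
    apply Limits.prod.hom_ext
    · simpa [r₁] using hfg₁
    · simpa [r₂] using hfg₂⟩
  obtain ⟨Q, q, hq⟩ := BarrExact.isKernelPair_of_isEquivalenceRelation r₁ r₂
    (isEquivalenceRelation_of_reflexive (coprod.inr ≫ F.e) (by simp [hr₁]) (by simp [hr₂]))
  have hXq : X.arrow ≫ q = 0 := by
    simpa [reassoc_of% hr₁, reassoc_of% hr₂] using (coprod.inl ≫= F.e ≫= hq.w).symm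
  refine ⟨Q, q, le_antisymm ?_ ?_⟩
  · exact le_kernelSubobject _ _ hXq
  · -- An element `t` of the kernel of `q` satisfies `0 R t`. After pulling back along the regular
    -- epimorphism `F.e`, it comes from the kernel of `[0, 1]`, hence lies in `X`.
    let t := (kernelSubobject q).arrow
    let g : (kernelSubobject q : C) ⟶ F.I := hq.lift 0 t (by simp [t])
    have hX' : X.Factors (pullback.fst F.e g ≫ coprod.desc X.arrow (𝟙 A)) := by
      refine factors_of_comp_desc_eq_zero hX _ ?_
      rw [← hr₁, pullback.condition_assoc, hq.lift_fst, comp_zero]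
    have sq : CommSq (X.factorThru _ hX') (pullback.snd F.e g) X.arrow t := ⟨by
      rw [Subobject.factorThru_arrow, ← hr₂, pullback.condition_assoc, hq.lift_snd]⟩
    exact Subobject.le_of_comm sq.lift sq.fac_right

/-- If the stable subobjects are the kernels, every equivalence relation is the kernel pair of any
morphism whose kernel is its zero class. -/
theorem barrExact_of_isProper_iff [Homological C] [HasBinaryCoproducts C]
    (h : ∀ (A : C) (X : Subobject A), IsProper X ↔ IsConjStable X) : BarrExact C where
  isKernelPair_of_isEquivalenceRelation := by
    rintro R A r₁ r₂ ⟨⟨e⟩⟩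
    have := e.toJointlyMono₂
    have := mono_zeroClass r₁ r₂
    obtain ⟨c, hc⟩ := exists_conj_factor_of_reflexive (r₁ := r₁) e.r e.reflexivity₂
    obtain ⟨B, f, hf⟩ := (h A _).2 (isConjStable_mk (kernel.ι r₁ ≫ r₂) c hc)
    refine ⟨B, f, isKernelPair_of_zeroClass e.r e.reflexivity₁ e.reflexivity₂ f ?_ ?_⟩
    · rw [← kernelSubobject_factors_iff, ← hf]
      exact Subobject.mk_factors_self _
    · intro T t ht
      rw [← kernelSubobject_factors_iff, ← hf] at ht
      exact (Subobject.mk_factors_iff _ _).1 ht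

end Exactness

end HomologicalCat

theorem mainTheorem2 (C : Type u) [Category.{v} C] [HasZeroMorphisms C]
    [HomologicalCat.Homological C] [HasFiniteColimits C] :
    List.TFAE [
      HomologicalCat.SemiAbelian C,
      HomologicalCat.BarrExact C,
      ∀ (A : C) (X : Subobject A),
        HomologicalCat.IsProper X ↔ HomologicalCat.IsConjStable X,
      ∀ (A : C) (X : Subobject A),
        HomologicalCat.IsProper X ↔ HomologicalCat.commutator X ⊤ ≤ X] := by
  tfae_have 1 → 2 := fun h => h.toBarrExact
  tfae_have 2 → 1 := fun h => { h with
    zero := HasZeroObject.zero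
    isIso_of_isIso_baseChange := HomologicalCat.Protomodular.isIso_of_isIso_baseChange
    has_colimit := fun F => inferInstance }
  tfae_have 2 → 3 := fun _ A X => ⟨fun h => h.isConjStable, fun h => h.isProper⟩
  tfae_have 3 → 2 := HomologicalCat.barrExact_of_isProper_iff
  tfae_have 3 ↔ 4 := by simp only [HomologicalCat.commutator_top_le_iff]
  tfae_finish
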